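/- Let $S$ be a commutative ring, $x\in S$ a non-zerodivisor, and $R=S/(x)$. A matrix factorization $(F,G,\varphi,\psi)$ of $x$ consists of finitely generated free $S$-modules $F,G$ and $S$-linear maps $\varphi\colon F\to G$, $\psi\colon G\to F$ with $\psi\varphi=x\cdot 1_F$ and $\varphi\psi=x\cdot 1_G$. A morphism $\theta=(f,g)\colon(F_1,G_1,\varphi_1,\psi_1)\to(F_2,G_2,\varphi_2,\psi_2)$ consists of $S$-linear maps $f\colon F_1\to F_2$, $g\colon G_1\to G_2$ with $\varphi_2f=g\varphi_1$ and $\psi_2g=f\psi_1$. Two morphisms $(f,g),(f',g')$ are homotopic if there are $S$-linear maps $s\colon G_1\to F_2$, $t\colon F_1\to G_2$ with $f-f'=s\varphi_1+\psi_2t$ and $g-g'=t\psi_1+\varphi_2s$. The category $\mathbf{HMF}(S,x)$ has the matrix factorizations of $x$ as objects and the homotopy classes $[\theta]$ of morphisms as morphisms. Its suspension $\Sigma$ is induced by $\Sigma(F,G,\varphi,\psi)=(G,F,-\psi,-\varphi)$, $\Sigma(f,g)=(g,f)$. Its distinguished triangles are those isomorphic to $$(F_1,G_1,\varphi_1,\psi_1)\xrightarrow{[\theta]}(F_2,G_2,\varphi_2,\psi_2)\xrightarrow{[i_\theta]}C_\theta\xrightarrow{[\pi_\theta]}\Sigma(F_1,G_1,\varphi_1,\psi_1),$$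 where $\theta=(f,g)$ is a morphism, $C_\theta$ is the matrix factorization $$G_1\oplus F_2\xrightarrow{\left[\begin{smallmatrix}-\psi_1&0\\ g&\varphi_2\end{smallmatrix}\right]}F_1\oplus G_2\xrightarrow{\left[\begin{smallmatrix}-\varphi_1&0\\ f&\psi_2\end{smallmatrix}\right]}G_1\oplus F_2,$$ and $i_\theta$, $\pi_\theta$ are the natural inclusion and projection. A complex $M$ (indexed by $\mathbb Z$) of finitely generated projective $R$-modules is totally acyclic if both $M$ and $\operatorname{Hom}_R(M,R)$ are acyclic. Let $\mathbf{K_{tac}}(\operatorname{proj}R)$ be the full triangulated subcategory of totally acyclic complexes in the homotopy category of complexes of finitely generated projective $R$-modules. To a matrix factorization $(F,G,\varphi,\psi)$ of $x$ assign the $2$-periodic complex $$\cdots\to F/xF\xrightarrow{\overline{\varphi}}G/xG\xrightarrow{\overline{\psi}}F/xF\xrightarrow{\overline{\varphi}}G/xG\to\cdots$$ of finitely generated free $R$-modules, with $F/xF$ in the even degrees, and to a morphism $(f,g)$ assign the morphism of complexes given by $\overline f$ and $\overline g$. Then each of these complexes is totally acyclic, and the assignment induces a functor $$T\colon\mathbf{HMF}(S,x)\to\mathbf{K_{tac}}(\operatorname{proj}R)$$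 that is a triangle functor (it is additive, and there is a natural isomorphism $\xi\colon T\Sigma\cong T(-)[1]$ such that for every distinguished triangle $X\xrightarrow{a}Y\xrightarrow{b}Z\xrightarrow{c}\Sigma X$ the triangle $TX\xrightarrow{Ta}TY\xrightarrow{Tb}TZ\xrightarrow{\xi_X\circ Tc}(TX)[1]$ is distinguished) and is fully faithful. -/

import Mathlib

open CategoryTheory CategoryTheory.Limits CategoryTheory.Pretriangulated

universe u

noncomputable section

/-! ## Matrix factorizations -/

/-- A matrix factorization `(F, G, φ, ψ)` of an element `x` of a commutative ring `S`:
finitely generated free `S`-modules `F`, `G` and `S`-linear maps `φ : F → G`, `ψ : G → F`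
with `ψ ∘ φ = x · 1_F` and `φ ∘ ψ = x · 1_G`. -/
structure MF (S : Type u) [CommRing S] (x : S) : Type (u + 1) where
  F : Type u
  G : Type u
  [addCommGroupF : AddCommGroup F]
  [moduleF : Module S F]
  [finiteF : Module.Finite S F]
  [freeF : Module.Free S F]
  [addCommGroupG : AddCommGroup G]
  [moduleG : Module S G]
  [finiteG : Module.Finite S G]
  [freeG : Module.Free S G]
  φ : F →ₗ[S] G
  ψ : G →ₗ[S] F
  ψ_comp_φ : ψ ∘ₗ φ = x • LinearMap.id
  φ_comp_ψ : φ ∘ₗ ψ = x • LinearMap.id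

namespace MF

attribute [instance] MF.addCommGroupF MF.moduleF MF.finiteF MF.freeF
  MF.addCommGroupG MF.moduleG MF.finiteG MF.freeG

variable {S : Type u} [CommRing S] {x : S}

/-- A morphism of matrix factorizations: a pair `(f, g)` making the two squares commute. -/
@[ext]
structure Hom (A B : MF S x) where
  f : A.F →ₗ[S] B.F
  g : A.G →ₗ[S] B.G
  comm_φ : B.φ ∘ₗ f = g ∘ₗ A.φ
  comm_ψ : B.ψ ∘ₗ g = f ∘ₗ A.ψ

instance : Category (MF S x) where
  Hom := Hom
  id A := { f := LinearMap.id, g := LinearMap.id, comm_φ := rfl, comm_ψ := rfl }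
  comp θ η :=
    { f := η.f ∘ₗ θ.f
      g := η.g ∘ₗ θ.g
      comm_φ := by
        rw [← LinearMap.comp_assoc, η.comm_φ, LinearMap.comp_assoc, θ.comm_φ,
          LinearMap.comp_assoc]
      comm_ψ := by
        rw [← LinearMap.comp_assoc, η.comm_ψ, LinearMap.comp_assoc, θ.comm_ψ,
          LinearMap.comp_assoc] }

@[ext]
lemma hom_ext {A B : MF S x} {θ η : A ⟶ B} (hf : θ.f = η.f) (hg : θ.g = η.g) : θ = η :=
  Hom.ext hf hg

@[simp] lemma id_f (A : MF S x) : Hom.f (𝟙 A) = LinearMap.id := rfl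
@[simp] lemma id_g (A : MF S x) : Hom.g (𝟙 A) = LinearMap.id := rfl
@[simp] lemma comp_f {A B C : MF S x} (θ : A ⟶ B) (η : B ⟶ C) : (θ ≫ η).f = η.f ∘ₗ θ.f := rfl
@[simp] lemma comp_g {A B C : MF S x} (θ : A ⟶ B) (η : B ⟶ C) : (θ ≫ η).g = η.g ∘ₗ θ.g := rfl

/-! Morphisms are added componentwise. -/

instance (A B : MF S x) : Zero (A ⟶ B) := ⟨{ f := 0, g := 0, comm_φ := by simp, comm_ψ := by simp }⟩

instance (A B : MF S x) : Add (A ⟶ B) :=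
  ⟨fun θ η =>
    { f := θ.f + η.f
      g := θ.g + η.g
      comm_φ := by rw [LinearMap.comp_add, LinearMap.add_comp, θ.comm_φ, η.comm_φ]
      comm_ψ := by rw [LinearMap.comp_add, LinearMap.add_comp, θ.comm_ψ, η.comm_ψ] }⟩

instance (A B : MF S x) : Neg (A ⟶ B) :=
  ⟨fun θ =>
    { f := -θ.f
      g := -θ.g
      comm_φ := by rw [LinearMap.comp_neg, LinearMap.neg_comp, θ.comm_φ]
      comm_ψ := by rw [LinearMap.comp_neg, LinearMap.neg_comp, θ.comm_ψ] }⟩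

@[simp] lemma zero_f (A B : MF S x) : Hom.f (0 : A ⟶ B) = 0 := rfl
@[simp] lemma zero_g (A B : MF S x) : Hom.g (0 : A ⟶ B) = 0 := rfl
@[simp] lemma add_f {A B : MF S x} (θ η : A ⟶ B) : (θ + η).f = θ.f + η.f := rfl
@[simp] lemma add_g {A B : MF S x} (θ η : A ⟶ B) : (θ + η).g = θ.g + η.g := rfl
@[simp] lemma neg_f {A B : MF S x} (θ : A ⟶ B) : (-θ).f = -θ.f := rfl
@[simp] lemma neg_g {A B : MF S x} (θ : A ⟶ B) : (-θ).g = -θ.g := rfl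

instance (A B : MF S x) : AddCommGroup (A ⟶ B) where
  add_assoc a b c := hom_ext (add_assoc _ _ _) (add_assoc _ _ _)
  zero_add a := hom_ext (zero_add _) (zero_add _)
  add_zero a := hom_ext (add_zero _) (add_zero _)
  add_comm a b := hom_ext (add_comm _ _) (add_comm _ _)
  neg_add_cancel a := hom_ext (neg_add_cancel _) (neg_add_cancel _)
  nsmul := nsmulRec
  zsmul := zsmulRec

instance : Preadditive (MF S x) where
  add_comp _ _ _ θ η κ := hom_ext (LinearMap.comp_add _ _ _) (LinearMap.comp_add _ _ _)
  comp_add _ _ _ θ η κ := hom_ext (LinearMap.add_comp _ _ _) (LinearMap.add_comp _ _ _)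

/-- Two morphisms `θ = (f, g)` and `θ' = (f', g')` from `A` to `B` are homotopic if there are
`s : G₁ → F₂` and `t : F₁ → G₂` with `f - f' = s ∘ φ₁ + ψ₂ ∘ t` and `g - g' = t ∘ ψ₁ + φ₂ ∘ s`. -/
def homotopic : HomRel (MF S x) := fun A B θ θ' =>
  ∃ (s : A.G →ₗ[S] B.F) (t : A.F →ₗ[S] B.G),
    θ.f - θ'.f = s ∘ₗ A.φ + B.ψ ∘ₗ t ∧ θ.g - θ'.g = t ∘ₗ A.ψ + B.φ ∘ₗ s

lemma homotopic_add {A B : MF S x} (θ₁ θ₂ η₁ η₂ : A ⟶ B) (h : homotopic θ₁ θ₂)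
    (h' : homotopic η₁ η₂) : homotopic (θ₁ + η₁) (θ₂ + η₂) := by
  obtain ⟨s, t, hf, hg⟩ := h
  obtain ⟨s', t', hf', hg'⟩ := h'
  refine ⟨s + s', t + t', ?_, ?_⟩
  · rw [add_f, add_f, add_sub_add_comm, hf, hf', LinearMap.add_comp, LinearMap.comp_add]
    abel
  · rw [add_g, add_g, add_sub_add_comm, hg, hg', LinearMap.add_comp, LinearMap.comp_add]
    abel

instance : Congruence (homotopic (S := S) (x := x)) where
  equivalence :=
    { refl := fun θ => ⟨0, 0, by simp, by simp⟩
      symm := by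
        rintro θ η ⟨s, t, hf, hg⟩
        refine ⟨-s, -t, ?_, ?_⟩
        · rw [← neg_sub, hf, LinearMap.neg_comp, LinearMap.comp_neg]; abel
        · rw [← neg_sub, hg, LinearMap.neg_comp, LinearMap.comp_neg]; abel
      trans := by
        rintro θ η κ ⟨s, t, hf, hg⟩ ⟨s', t', hf', hg'⟩
        refine ⟨s + s', t + t', ?_, ?_⟩
        · rw [← sub_add_sub_cancel θ.f η.f κ.f, hf, hf', LinearMap.add_comp, LinearMap.comp_add]
          abel
        · rw [← sub_add_sub_cancel θ.g η.g κ.g, hg, hg', LinearMap.add_comp, LinearMap.comp_add]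
          abel }
  comp_left := by
    rintro A B C θ η η' ⟨s, t, hf, hg⟩
    refine ⟨s ∘ₗ θ.g, t ∘ₗ θ.f, ?_, ?_⟩
    · rw [comp_f, comp_f, ← LinearMap.sub_comp, hf, LinearMap.add_comp, LinearMap.comp_assoc,
        θ.comm_φ, LinearMap.comp_assoc, LinearMap.comp_assoc]
    · rw [comp_g, comp_g, ← LinearMap.sub_comp, hg, LinearMap.add_comp, LinearMap.comp_assoc,
        θ.comm_ψ, LinearMap.comp_assoc, LinearMap.comp_assoc]
  comp_right := by
    rintro A B C θ θ' η ⟨s, t, hf, hg⟩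
    refine ⟨η.f ∘ₗ s, η.g ∘ₗ t, ?_, ?_⟩
    · rw [comp_f, comp_f, ← LinearMap.comp_sub, hf, LinearMap.comp_add, ← LinearMap.comp_assoc,
        ← LinearMap.comp_assoc, ← LinearMap.comp_assoc, η.comm_ψ]
    · rw [comp_g, comp_g, ← LinearMap.comp_sub, hg, LinearMap.comp_add, ← LinearMap.comp_assoc,
        ← LinearMap.comp_assoc, ← LinearMap.comp_assoc, η.comm_φ]

/-- The suspension `Σ(F, G, φ, ψ) = (G, F, -ψ, -φ)`, as a functor on matrix factorizations. -/
def suspension : MF S x ⥤ MF S x where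
  obj A :=
    { F := A.G
      G := A.F
      φ := -A.ψ
      ψ := -A.φ
      ψ_comp_φ := by rw [LinearMap.neg_comp, LinearMap.comp_neg, neg_neg, A.φ_comp_ψ]
      φ_comp_ψ := by rw [LinearMap.neg_comp, LinearMap.comp_neg, neg_neg, A.ψ_comp_φ] }
  map θ :=
    { f := θ.g
      g := θ.f
      comm_φ := by simpa using θ.comm_ψ
      comm_ψ := by simpa using θ.comm_φ }

/-- The mapping cone of `θ = (f, g) : (F₁, G₁, φ₁, ψ₁) ⟶ (F₂, G₂, φ₂, ψ₂)`, with modules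
`G₁ ⊕ F₂` and `F₁ ⊕ G₂` and maps `(u, b) ↦ (-ψ₁ u, g u + φ₂ b)`, `(a, v) ↦ (-φ₁ a, f a + ψ₂ v)`. -/
def cone {A B : MF S x} (θ : A ⟶ B) : MF S x where
  F := A.G × B.F
  G := A.F × B.G
  φ := LinearMap.prod (-(A.ψ ∘ₗ LinearMap.fst S A.G B.F))
    (θ.g ∘ₗ LinearMap.fst S A.G B.F + B.φ ∘ₗ LinearMap.snd S A.G B.F)
  ψ := LinearMap.prod (-(A.φ ∘ₗ LinearMap.fst S A.F B.G))
    (θ.f ∘ₗ LinearMap.fst S A.F B.G + B.ψ ∘ₗ LinearMap.snd S A.F B.G)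
  ψ_comp_φ := by
    ext u
    · simpa using LinearMap.congr_fun A.φ_comp_ψ u
    · simpa using neg_add_eq_zero.2 (LinearMap.congr_fun θ.comm_ψ u).symm
    · simp
    · simpa using LinearMap.congr_fun B.ψ_comp_φ u
  φ_comp_ψ := by
    ext u
    · simpa using LinearMap.congr_fun A.ψ_comp_φ u
    · simpa using neg_add_eq_zero.2 (LinearMap.congr_fun θ.comm_φ u).symm
    · simp
    · simpa using LinearMap.congr_fun B.φ_comp_ψ u

/-- The natural map `i_θ` from the target of `θ` to its mapping cone. -/
def coneInr {A B : MF S x} (θ : A ⟶ B) : B ⟶ cone θ where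
  f := LinearMap.inr S A.G B.F
  g := LinearMap.inr S A.F B.G
  comm_φ := LinearMap.ext fun u => Prod.ext
    (show -(A.ψ 0) = 0 by simp) (show θ.g 0 + B.φ u = B.φ u by simp)
  comm_ψ := LinearMap.ext fun u => Prod.ext
    (show -(A.φ 0) = 0 by simp) (show θ.f 0 + B.ψ u = B.ψ u by simp)

/-- The natural map `π_θ` from the mapping cone of `θ` to the suspension of its source. -/
def coneFst {A B : MF S x} (θ : A ⟶ B) : cone θ ⟶ suspension.obj A where
  f := LinearMap.fst S A.G B.F
  g := LinearMap.fst S A.F B.G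
  comm_φ := rfl
  comm_ψ := rfl

end MF

/-- The homotopy category of matrix factorizations of `x` over `S`: the objects are the matrix
factorizations, the morphisms are the homotopy classes of morphisms. -/
abbrev HMF (S : Type u) [CommRing S] (x : S) :=
  CategoryTheory.Quotient (MF.homotopic (S := S) (x := x))

namespace HMF

variable {S : Type u} [CommRing S] {x : S}

instance : Preadditive (HMF S x) :=
  CategoryTheory.Quotient.preadditive _ (fun _ _ => MF.homotopic_add)

/-- The functor from matrix factorizations to their homotopy category, `θ ↦ [θ]`. -/
abbrev quotient : MF S x ⥤ HMF S x := CategoryTheory.Quotient.functor _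

/-- The suspension functor of the homotopy category of matrix factorizations. -/
def suspension : HMF S x ⥤ HMF S x :=
  CategoryTheory.Quotient.lift _ (MF.suspension ⋙ quotient) (by
    rintro A B θ η ⟨s, t, hf, hg⟩
    refine CategoryTheory.Quotient.sound _ ⟨-t, -s, ?_, ?_⟩
    · change θ.g - η.g = (-t) ∘ₗ (-A.ψ) + (-B.φ) ∘ₗ (-s)
      simpa using hg
    · change θ.f - η.f = (-s) ∘ₗ (-A.φ) + (-B.ψ) ∘ₗ (-t)
      simpa using hf)

/-- The morphism `[π_θ]` from the mapping cone of `θ : A ⟶ B` to `Σ A`. -/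
abbrev coneFst {A B : MF S x} (θ : A ⟶ B) :
    quotient.obj (MF.cone θ) ⟶ suspension.obj (quotient.obj A) :=
  quotient.map (MF.coneFst θ)

/-- The distinguished triangles `X ⟶ Y ⟶ Z ⟶ Σ X`: those isomorphic to a standard triangle
`A ⟶ B ⟶ C_θ ⟶ Σ A` with maps `[θ]`, `[i_θ]`, `[π_θ]`, for a morphism `θ` of matrix
factorizations. -/
def Distinguished {X Y Z : HMF S x} (a : X ⟶ Y) (b : Y ⟶ Z) (c : Z ⟶ suspension.obj X) : Prop :=
  ∃ (A B : MF S x) (θ : A ⟶ B) (e₁ : X ≅ quotient.obj A) (e₂ : Y ≅ quotient.obj B)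
    (e₃ : Z ≅ quotient.obj (MF.cone θ)),
    a ≫ e₂.hom = e₁.hom ≫ quotient.map θ ∧
    b ≫ e₃.hom = e₂.hom ≫ quotient.map (MF.coneInr θ) ∧
    c ≫ suspension.map e₁.hom = e₃.hom ≫ coneFst θ

end HMF

/-! ## The homotopy category of totally acyclic complexes -/

section TotallyAcyclic

variable (R : Type u) [CommRing R]

/-- Being a finitely generated projective module. -/
def isFGProj : ObjectProperty (ModuleCat.{u} R) :=
  fun M => Module.Finite R M ∧ Module.Projective R M

/-- The category `proj R` of finitely generated projective `R`-modules. -/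
abbrev FGProj := (isFGProj R).FullSubcategory

instance : (isFGProj R).IsClosedUnderIsomorphisms where
  of_iso e h :=
    have := h.1
    have := h.2
    ⟨Module.Finite.equiv e.toLinearEquiv, Module.Projective.of_equiv e.toLinearEquiv⟩

instance : (isFGProj R).ContainsZero where
  exists_zero := ⟨ModuleCat.of R PUnit.{u + 1}, ModuleCat.isZero_of_subsingleton _,
    inferInstanceAs (Module.Finite R PUnit.{u + 1}),
    inferInstanceAs (Module.Projective R PUnit.{u + 1})⟩

instance : (isFGProj R).IsClosedUnderBinaryProducts where
  limitsOfShape_le := by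
    rintro X ⟨p⟩
    have hl := p.prop_diag_obj (.mk .left)
    have hr := p.prop_diag_obj (.mk .right)
    have := hl.1
    have := hl.2
    have := hr.1
    have := hr.2
    refine (isFGProj R).prop_of_iso (X := ModuleCat.of R
      (p.diag.obj (.mk .left) × p.diag.obj (.mk .right))) ?_
      ⟨inferInstanceAs (Module.Finite R
        (p.diag.obj (.mk .left) × p.diag.obj (.mk .right))),
      inferInstanceAs (Module.Projective R
        (p.diag.obj (.mk .left) × p.diag.obj (.mk .right)))⟩
    exact IsLimit.conePointUniqueUpToIso (ModuleCat.binaryProductLimitCone _ _).isLimit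
      ((IsLimit.postcomposeHomEquiv (diagramIsoPair p.diag) _).2 p.isLimit)

instance : (isFGProj R).IsClosedUnderFiniteProducts :=
  ObjectProperty.IsClosedUnderFiniteProducts.mk'

instance : HasFiniteProducts (FGProj R) := inferInstance

instance : HasBinaryBiproducts (FGProj R) := HasBinaryBiproducts.of_hasBinaryProducts

variable {R}

/-- The `R`-linear map underlying a morphism in `proj R`. -/
abbrev FGProj.lin {P Q : FGProj R} (f : P ⟶ Q) : P.obj →ₗ[R] Q.obj := f.hom.hom

/-- A complex `M` of finitely generated projective modules is totally acyclic if both `M` and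
the dual complex `Hom_R(M, R)` are acyclic. -/
structure IsTotallyAcyclic (M : CochainComplex (FGProj R) ℤ) : Prop where
  exact : ∀ i : ℤ, Function.Exact (FGProj.lin (M.d (i - 1) i)) (FGProj.lin (M.d i (i + 1)))
  exact_dual : ∀ i : ℤ, Function.Exact (FGProj.lin (M.d i (i + 1))).dualMap
    (FGProj.lin (M.d (i - 1) i)).dualMap

variable (R)

/-- The totally acyclic complexes, as a class of objects of the homotopy category of complexes
of finitely generated projective modules. -/
def totallyAcyclic : ObjectProperty (HomotopyCategory (FGProj R) (ComplexShape.up ℤ)) :=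
  fun X => IsTotallyAcyclic X.as

/-- The functor `Hom_R(-, R)`, with values in the opposite category. -/
def FGProj.dual : FGProj R ⥤ (ModuleCat.{u} R)ᵒᵖ where
  obj P := Opposite.op (ModuleCat.of R (Module.Dual R P.obj))
  map f := (ModuleCat.ofHom (FGProj.lin f).dualMap).op

instance : (FGProj.dual R).Additive where
  map_add {P Q f g} := by
    apply Quiver.Hom.unop_inj
    refine ModuleCat.hom_ext (LinearMap.ext fun φ => LinearMap.ext fun p => ?_)
    exact map_add (show Q.obj →ₗ[R] R from φ) _ _

lemma totallyAcyclic_eq : totallyAcyclic R =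
    (HomotopyCategory.subcategoryAcyclic (ModuleCat.{u} R)).inverseImage
      ((isFGProj R).ι.mapHomotopyCategory (ComplexShape.up ℤ)) ⊓
    (HomotopyCategory.subcategoryAcyclic (ModuleCat.{u} R)ᵒᵖ).inverseImage
      ((FGProj.dual R).mapHomotopyCategory (ComplexShape.up ℤ)) := by
  ext X
  obtain ⟨M, rfl⟩ := HomotopyCategory.quotient_obj_surjective X
  have h₁ : (HomotopyCategory.subcategoryAcyclic (ModuleCat.{u} R)).inverseImage
      ((isFGProj R).ι.mapHomotopyCategory (ComplexShape.up ℤ))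
        ((HomotopyCategory.quotient _ _).obj M) ↔
      ∀ i : ℤ, Function.Exact (FGProj.lin (M.d (i - 1) i)) (FGProj.lin (M.d i (i + 1))) := by
    refine (HomotopyCategory.quotient_obj_mem_subcategoryAcyclic_iff_exactAt
      (((isFGProj R).ι.mapHomologicalComplex (ComplexShape.up ℤ)).obj M)).trans
        (forall_congr' fun i => ?_)
    rw [HomologicalComplex.exactAt_iff' _ (i - 1) i (i + 1) (by simp) (by simp)]
    exact ShortComplex.ShortExact.moduleCat_exact_iff_function_exact _
  have h₂ : (HomotopyCategory.subcategoryAcyclic (ModuleCat.{u} R)ᵒᵖ).inverseImage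
      ((FGProj.dual R).mapHomotopyCategory (ComplexShape.up ℤ))
        ((HomotopyCategory.quotient _ _).obj M) ↔
      ∀ i : ℤ, Function.Exact (FGProj.lin (M.d i (i + 1))).dualMap
        (FGProj.lin (M.d (i - 1) i)).dualMap := by
    refine (HomotopyCategory.quotient_obj_mem_subcategoryAcyclic_iff_exactAt
      (((FGProj.dual R).mapHomologicalComplex (ComplexShape.up ℤ)).obj M)).trans
        (forall_congr' fun i => ?_)
    rw [HomologicalComplex.exactAt_iff' _ (i - 1) i (i + 1) (by simp) (by simp),
      ← ShortComplex.exact_unop_iff]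
    exact ShortComplex.ShortExact.moduleCat_exact_iff_function_exact _
  exact ⟨fun h => ⟨h₁.2 h.1, h₂.2 h.2⟩, fun h => ⟨h₁.1 h.1, h₂.1 h.2⟩⟩

instance : (totallyAcyclic R).IsTriangulated := by
  rw [totallyAcyclic_eq]
  infer_instance

/-- The homotopy category of totally acyclic complexes of finitely generated projective
`R`-modules, with the triangulated structure inherited from the homotopy category of complexes
over `proj R`. -/
abbrev Ktac := (totallyAcyclic R).FullSubcategory

end TotallyAcyclic

/-! ## Reduction modulo `x` -/

section Reduction

variable {S : Type u} [CommRing S] (x : S)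

/-- The `S/(x)`-module `N/xN`. -/
abbrev Red (N : Type u) [AddCommGroup N] [Module S N] : Type u :=
  N ⧸ (Ideal.span {x} • ⊤ : Submodule S N)

/-- The reduction `N/xN → N'/xN'` of an `S`-linear map `N → N'`. -/
def redMap {N N' : Type u} [AddCommGroup N] [Module S N] [AddCommGroup N'] [Module S N']
    (f : N →ₗ[S] N') : Red x N →ₗ[S ⧸ Ideal.span {x}] Red x N' :=
  LinearMap.extendScalarsOfSurjective (S := S ⧸ Ideal.span {x}) Ideal.Quotient.mk_surjective
    (Submodule.mapQ _ _ f (Submodule.smul_top_le_comap_smul_top (Ideal.span {x}) f))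

@[simp]
lemma redMap_mk {N N' : Type u} [AddCommGroup N] [Module S N] [AddCommGroup N'] [Module S N']
    (f : N →ₗ[S] N') (n : N) :
    redMap x f (Submodule.Quotient.mk n) = Submodule.Quotient.mk (f n) := rfl

variable {x} in
lemma redMap_comp_eq_zero {N N' : Type u} [AddCommGroup N] [Module S N] [AddCommGroup N']
    [Module S N'] (f : N →ₗ[S] N') (g : N' →ₗ[S] N) (h : g ∘ₗ f = x • LinearMap.id) :
    redMap x g ∘ₗ redMap x f = 0 := by
  refine LinearMap.ext fun n => ?_
  obtain ⟨n, rfl⟩ := Submodule.Quotient.mk_surjective _ n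
  have h' : g (f n) = x • n := LinearMap.congr_fun h n
  rw [LinearMap.comp_apply, redMap_mk, redMap_mk, h', LinearMap.zero_apply,
    Submodule.Quotient.mk_eq_zero]
  exact Submodule.smul_mem_smul (Ideal.mem_span_singleton_self x) trivial

variable {x} in
lemma redMap_comp_redMap {N₁ N₂ N₃ : Type u} [AddCommGroup N₁] [Module S N₁] [AddCommGroup N₂]
    [Module S N₂] [AddCommGroup N₃] [Module S N₃] (f : N₁ →ₗ[S] N₂) (g : N₂ →ₗ[S] N₃) :
    redMap x g ∘ₗ redMap x f = redMap x (g ∘ₗ f) := by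
  refine LinearMap.ext fun n => ?_
  obtain ⟨n, rfl⟩ := Submodule.Quotient.mk_surjective _ n
  rfl

variable {x} in
lemma redMap_id (N : Type u) [AddCommGroup N] [Module S N] :
    redMap x (LinearMap.id : N →ₗ[S] N) = LinearMap.id := by
  refine LinearMap.ext fun n => ?_
  obtain ⟨n, rfl⟩ := Submodule.Quotient.mk_surjective _ n
  rfl

instance (N : Type u) [AddCommGroup N] [Module S N] [Module.Free S N] :
    Module.Free (S ⧸ Ideal.span {x}) (Red x N) :=
  Module.Free.of_equiv (LinearEquiv.extendScalarsOfSurjective (S := S ⧸ Ideal.span {x})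
    Ideal.Quotient.mk_surjective (TensorProduct.quotTensorEquivQuotSMul N (Ideal.span {x})))

/-- `N/xN` as an object of `proj S/(x)`, for a finitely generated free `S`-module `N`. -/
abbrev redObj (N : Type u) [AddCommGroup N] [Module S N] [Module.Finite S N] [Module.Free S N] :
    FGProj (S ⧸ Ideal.span {x}) :=
  ⟨ModuleCat.of _ (Red x N), inferInstanceAs (Module.Finite _ (Red x N)),
    inferInstanceAs (Module.Projective _ (Red x N))⟩

/-- The reduction of a linear map as a morphism of `proj S/(x)`. -/
abbrev redHom {N N' : Type u} [AddCommGroup N] [Module S N] [Module.Finite S N] [Module.Free S N]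
    [AddCommGroup N'] [Module S N'] [Module.Finite S N'] [Module.Free S N'] (f : N →ₗ[S] N') :
    redObj x N ⟶ redObj x N' :=
  ObjectProperty.homMk (ModuleCat.ofHom (redMap x f))

variable {x}

namespace MF

/-- `F/xF` for the parity `false` (even), `G/xG` for the parity `true` (odd). -/
def redX (A : MF S x) : Bool → FGProj (S ⧸ Ideal.span {x})
  | false => redObj x A.F
  | true => redObj x A.G

/-- The differentials: `φ` modulo `x` from even to odd, `ψ` modulo `x` from odd to even. -/
def redD (A : MF S x) : (a b : Bool) → (A.redX a ⟶ A.redX b)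
  | false, true => redHom x A.φ
  | true, false => redHom x A.ψ
  | false, false => 0
  | true, true => 0

/-- `f` modulo `x` in even parity, `g` modulo `x` in odd parity. -/
def redF {A B : MF S x} (θ : A ⟶ B) : (a : Bool) → (A.redX a ⟶ B.redX a)
  | false => redHom x θ.f
  | true => redHom x θ.g

lemma redHom_comp_eq_zero {N N' : Type u} [AddCommGroup N] [Module S N] [Module.Finite S N]
    [Module.Free S N] [AddCommGroup N'] [Module S N'] [Module.Finite S N'] [Module.Free S N']
    (f : N →ₗ[S] N') (g : N' →ₗ[S] N) (h : g ∘ₗ f = x • LinearMap.id) :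
    redHom x f ≫ redHom x g = 0 :=
  ObjectProperty.hom_ext _ (ModuleCat.hom_ext (redMap_comp_eq_zero f g h))

lemma redD_comp_redD (A : MF S x) (a b c : Bool) : A.redD a b ≫ A.redD b c = 0 := by
  cases a <;> cases b <;> cases c <;> first
    | exact zero_comp
    | exact comp_zero
    | exact redHom_comp_eq_zero _ _ A.ψ_comp_φ
    | exact redHom_comp_eq_zero _ _ A.φ_comp_ψ

lemma redHom_comp_redHom {N₁ N₂ N₃ : Type u} [AddCommGroup N₁] [Module S N₁] [Module.Finite S N₁]
    [Module.Free S N₁] [AddCommGroup N₂] [Module S N₂] [Module.Finite S N₂] [Module.Free S N₂]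
    [AddCommGroup N₃] [Module S N₃] [Module.Finite S N₃] [Module.Free S N₃]
    (f : N₁ →ₗ[S] N₂) (g : N₂ →ₗ[S] N₃) :
    redHom x f ≫ redHom x g = redHom x (g ∘ₗ f) :=
  ObjectProperty.hom_ext _ (ModuleCat.hom_ext (redMap_comp_redMap f g))

lemma redHom_id (N : Type u) [AddCommGroup N] [Module S N] [Module.Finite S N]
    [Module.Free S N] : redHom x (LinearMap.id : N →ₗ[S] N) = 𝟙 (redObj x N) :=
  ObjectProperty.hom_ext _ (ModuleCat.hom_ext (redMap_id N))

lemma redF_comm {A B : MF S x} (θ : A ⟶ B) (a b : Bool) :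
    redF θ a ≫ B.redD a b = A.redD a b ≫ redF θ b := by
  cases a <;> cases b
  · exact comp_zero.trans zero_comp.symm
  · exact (redHom_comp_redHom _ _).trans
      ((congrArg (redHom x) θ.comm_φ).trans (redHom_comp_redHom _ _).symm)
  · exact (redHom_comp_redHom _ _).trans
      ((congrArg (redHom x) θ.comm_ψ).trans (redHom_comp_redHom _ _).symm)
  · exact comp_zero.trans zero_comp.symm

lemma redF_id (A : MF S x) (a : Bool) : redF (𝟙 A) a = 𝟙 (A.redX a) := by
  cases a
  · exact redHom_id A.F
  · exact redHom_id A.G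

lemma redF_comp {A B C : MF S x} (θ : A ⟶ B) (η : B ⟶ C) (a : Bool) :
    redF (θ ≫ η) a = redF θ a ≫ redF η a := by
  cases a <;> exact (redHom_comp_redHom _ _).symm

/-- The functor that sends a matrix factorization `(F, G, φ, ψ)` to the `2`-periodic complex
`⋯ ⟶ F/xF ⟶ G/xG ⟶ F/xF ⟶ ⋯` over `S/(x)`, with differentials `φ` and `ψ` modulo `x` and with
`F/xF` in the even degrees, and a morphism `(f, g)` to the morphism given by `f` and `g`
modulo `x`. -/
def reduction : MF S x ⥤ CochainComplex (FGProj (S ⧸ Ideal.span {x})) ℤ where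
  obj A :=
    { X := fun n => A.redX n.bodd
      d := fun i j => if i + 1 = j then A.redD i.bodd j.bodd else 0
      shape := fun i j h => if_neg h
      d_comp_d' := by
        intro i j k (hij : i + 1 = j) (hjk : j + 1 = k)
        rw [if_pos hij, if_pos hjk]
        exact A.redD_comp_redD _ _ _ }
  map θ :=
    { f := fun n => redF θ n.bodd
      comm' := by
        intro i j (hij : i + 1 = j)
        dsimp only
        rw [if_pos hij, if_pos hij]
        exact redF_comm θ _ _ }
  map_id A := by
    ext1 n
    exact redF_id A _
  map_comp θ η := by
    ext1 n
    exact redF_comp θ η _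

end MF

/-- A functor `T` from `HMF(S, x)` to the homotopy category of totally acyclic complexes, with a
natural isomorphism `ξ : T(Σ X) ≅ (T X)[1]`, is a triangle functor if it is additive and maps
distinguished triangles to distinguished triangles. -/
structure IsTriangleFunctor (T : HMF S x ⥤ Ktac (S ⧸ Ideal.span {x}))
    (ξ : HMF.suspension ⋙ T ≅ T ⋙ shiftFunctor (Ktac (S ⧸ Ideal.span {x})) (1 : ℤ)) : Prop where
  additive : T.Additive
  map_distinguished : ∀ {X Y Z : HMF S x} (a : X ⟶ Y) (b : Y ⟶ Z) (c : Z ⟶ HMF.suspension.obj X),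
    HMF.Distinguished a b c →
      Triangle.mk (T.map a) (T.map b) (T.map c ≫ ξ.hom.app X) ∈
        distTriang (Ktac (S ⧸ Ideal.span {x}))

end Reduction

end

-- Two facts drive the proof: `x` cancels on free `S`-modules, and `S/(x)`-linear maps between
-- reductions of free modules lift to `S`. If `a ∘ φ` vanishes modulo `x`, write `a φ = x b`; then
-- `x a = a φ ψ = x b ψ`, so `a = b ψ`. Hence maps into reductions of free modules extend along the
-- differentials (`exists_eq_comp_redMap`). Target `S/(x)` gives acyclicity of the dual, and the
-- same computation on elements gives acyclicity (`redMap_exact`).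
--
-- With lifting against projectives on the other side, a chain map between reductions that vanishes
-- in degree 0 is null-homotopic (`MF.exists_homotopy_zero`). For fullness it therefore suffices to
-- realise a degree-0 component: lift degrees 0 and 1 to `f` and `g`, and absorb the error `φ f - g
-- φ = x u` by replacing `g` with `g + u ψ`. For faithfulness, lift a homotopy in degree 0 to `s`
-- and `t`; the error `x u = ψ φ u` is absorbed in `t`, and the equation for `g` follows after
-- multiplication by `x`.
--
-- For triangles, the reduction of `C_θ` is the mapping cone of the reduction, block by block. The
-- reduction of `Σ A` and the shift have the same differentials, but `ξ` is minus the identity,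
-- because the third map of the standard triangle of complexes is minus the projection
-- (`MF.reductionConeIso_comp_mor₃`).

universe v

noncomputable section

/-! ### Linear maps modulo a non-zero-divisor -/

section ReductionAlgebra

variable {S : Type u} [CommRing S] {x : S}
variable {N N' H : Type u} [AddCommGroup N] [Module S N] [AddCommGroup N'] [Module S N']
  [AddCommGroup H] [Module S H]

lemma smul_cancel_of_free (hx : x ∈ nonZeroDivisors S) [Module.Free S N] {m n : N}
    (h : x • m = x • n) : m = n := by
  let b := Module.Free.chooseBasis S N
  refine b.ext_elem fun i => ?_
  have h' := congrArg (fun n => b.repr n i) h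
  simp only [map_smul, Finsupp.smul_apply, smul_eq_mul] at h'
  exact (mul_cancel_left_mem_nonZeroDivisors hx).1 h'

lemma smul_linearMap_cancel (hx : x ∈ nonZeroDivisors S) [Module.Free S N'] {f g : N →ₗ[S] N'}
    (h : x • f = x • g) : f = g :=
  LinearMap.ext fun n => smul_cancel_of_free hx (LinearMap.congr_fun h n)

lemma Red.mk_eq_zero_iff (n : N) : (Submodule.Quotient.mk n : Red x N) = 0 ↔ ∃ m, n = x • m := by
  rw [Submodule.Quotient.mk_eq_zero, Submodule.ideal_span_singleton_smul,
    Submodule.mem_smul_pointwise_iff_exists]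
  simp [eq_comm]

@[simp]
lemma redMap_add (f g : N →ₗ[S] N') : redMap x (f + g) = redMap x f + redMap x g := by
  refine LinearMap.ext fun n => ?_
  obtain ⟨n, rfl⟩ := Submodule.Quotient.mk_surjective _ n
  rfl

@[simp]
lemma redMap_sub (f g : N →ₗ[S] N') : redMap x (f - g) = redMap x f - redMap x g := by
  refine LinearMap.ext fun n => ?_
  obtain ⟨n, rfl⟩ := Submodule.Quotient.mk_surjective _ n
  rfl

@[simp]
lemma redMap_neg (f : N →ₗ[S] N') : redMap x (-f) = -redMap x f := by
  refine LinearMap.ext fun n => ?_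
  obtain ⟨n, rfl⟩ := Submodule.Quotient.mk_surjective _ n
  rfl

@[simp]
lemma redMap_zero : redMap x (0 : N →ₗ[S] N') = 0 := by
  refine LinearMap.ext fun n => ?_
  obtain ⟨n, rfl⟩ := Submodule.Quotient.mk_surjective _ n
  rfl

/-- Cancelling `x` makes the pointwise quotient by `x` unique, hence linear. -/
lemma exists_smul_eq_of_redMap_eq_zero (hx : x ∈ nonZeroDivisors S) [Module.Free S N']
    {f : N →ₗ[S] N'} (hf : redMap x f = 0) : ∃ g : N →ₗ[S] N', f = x • g := by
  have key : ∀ n, ∃ m, f n = x • m := fun n =>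
    (Red.mk_eq_zero_iff _).1 (LinearMap.congr_fun hf (Submodule.Quotient.mk n))
  choose g hg using key
  refine ⟨{ toFun := g, map_add' := fun m n => ?_, map_smul' := fun r n => ?_ },
    LinearMap.ext hg⟩
  · exact smul_cancel_of_free hx (by rw [← hg, smul_add, ← hg, ← hg, map_add])
  · exact smul_cancel_of_free hx
      (by rw [← hg, map_smul, RingHom.id_apply, smul_comm, ← hg])

/-- `N` is projective over `S`, so `N → N/xN → N'/xN'` lifts along `N' → N'/xN'`. -/
lemma redMap_surjective [Module.Free S N] :
    Function.Surjective (redMap x : (N →ₗ[S] N') → _) := by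
  intro g
  obtain ⟨f, hf⟩ := Module.projective_lifting_property
    (Submodule.mkQ (Ideal.span {x} • ⊤ : Submodule S N'))
    (g.restrictScalars S ∘ₗ Submodule.mkQ (Ideal.span {x} • ⊤ : Submodule S N))
    (Submodule.mkQ_surjective _)
  refine ⟨f, LinearMap.ext fun n => ?_⟩
  obtain ⟨n, rfl⟩ := Submodule.Quotient.mk_surjective _ n
  exact LinearMap.congr_fun hf n

/-- `S/xS` computed as a module is the ring `S/(x)`. -/
def redSelfEquiv (x : S) : Red x S ≃ₗ[S ⧸ Ideal.span {x}] S ⧸ Ideal.span {x} :=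
  LinearEquiv.extendScalarsOfSurjective (S := S ⧸ Ideal.span {x}) Ideal.Quotient.mk_surjective
    (Submodule.quotEquivOfEq _ _ (by rw [smul_eq_mul, Ideal.mul_top]))

section Factorization

variable {f : N →ₗ[S] N'} {g : N' →ₗ[S] N}

/-- If `g n = x m`, then `x (f m) = f (g n) = x n`, so `f m = n` already over `S`. -/
lemma redMap_exact (hx : x ∈ nonZeroDivisors S) [Module.Free S N'] (hgf : g ∘ₗ f = x • LinearMap.id)
    (hfg : f ∘ₗ g = x • LinearMap.id) : Function.Exact (redMap x f) (redMap x g) := by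
  refine LinearMap.exact_of_comp_of_mem_range (redMap_comp_eq_zero f g hgf) fun n hn => ?_
  obtain ⟨n, rfl⟩ := Submodule.Quotient.mk_surjective _ n
  obtain ⟨m, hm⟩ := (Red.mk_eq_zero_iff _).1 hn
  refine ⟨Submodule.Quotient.mk m, congrArg Submodule.Quotient.mk (smul_cancel_of_free hx ?_)⟩
  rw [← map_smul, ← hm]
  exact LinearMap.congr_fun hfg n

/-- Exactness of `Hom(-, H/xH)`: the case `H = S` serves the dual complex, general `H` the extension
of homotopies. -/
lemma exists_eq_comp_redMap (hx : x ∈ nonZeroDivisors S) [Module.Free S N'] [Module.Free S H]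
    (hfg : f ∘ₗ g = x • LinearMap.id)
    (a : Red x N' →ₗ[S ⧸ Ideal.span {x}] Red x H) (ha : a ∘ₗ redMap x f = 0) :
    ∃ b : Red x N →ₗ[S ⧸ Ideal.span {x}] Red x H, a = b ∘ₗ redMap x g := by
  obtain ⟨a, rfl⟩ := redMap_surjective a
  rw [redMap_comp_redMap] at ha
  obtain ⟨b, hb⟩ := exists_smul_eq_of_redMap_eq_zero hx ha
  refine ⟨redMap x b, ?_⟩
  rw [redMap_comp_redMap]
  congr 1
  apply smul_linearMap_cancel hx
  rw [← LinearMap.smul_comp, ← hb, LinearMap.comp_assoc, hfg, LinearMap.comp_smul,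
    LinearMap.comp_id]

lemma redMap_exact_dual (hx : x ∈ nonZeroDivisors S) [Module.Free S N'] (hgf : g ∘ₗ f = x • LinearMap.id)
    (hfg : f ∘ₗ g = x • LinearMap.id) :
    Function.Exact (redMap x g).dualMap (redMap x f).dualMap := by
  intro a
  constructor
  · intro ha
    -- Functionals take values in the ring `S/(x)`; `redSelfEquiv` makes it a reduced free module,
    -- so that the case `H = S` applies.
    obtain ⟨b, hb⟩ := exists_eq_comp_redMap hx hfg ((redSelfEquiv x).symm.toLinearMap ∘ₗ a)
      (by
        rw [LinearMap.comp_assoc]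
        exact (congrArg _ ha).trans (LinearMap.comp_zero _))
    refine ⟨(redSelfEquiv x).toLinearMap ∘ₗ b, LinearMap.ext fun n => ?_⟩
    exact (redSelfEquiv x).symm.injective
      (((redSelfEquiv x).symm_apply_apply _).trans (LinearMap.congr_fun hb n).symm)
  · rintro ⟨b, rfl⟩
    refine LinearMap.ext fun n => ?_
    exact (congrArg b (LinearMap.congr_fun (redMap_comp_eq_zero f g hgf) n)).trans (map_zero b)

end Factorization

end ReductionAlgebra

/-! ### Null-homotopies built degree by degree -/

/-- A family indexed by `ℤ` whose consecutive members are related, built outwards from `0`. -/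
lemma exists_int_family {X : ℤ → Type*} (r : ∀ i, X i → X (i + 1) → Prop) (x₀ : X 0)
    (up : ∀ i a, ∃ b, r i a b) (down : ∀ i b, ∃ a, r i a b) :
    ∃ y : ∀ i, X i, ∀ i, r i (y i) (y (i + 1)) := by
  choose u hu using up
  choose d hd using down
  let pos : ∀ n : ℕ, X (Int.ofNat n) := fun n =>
    Nat.rec x₀ (fun n a => (u (Int.ofNat n) a : X (Int.ofNat n + 1))) n
  let neg : ∀ n : ℕ, X (Int.negSucc n) := fun n =>
    Nat.rec (d (Int.negSucc 0) x₀) (fun n a => d (Int.negSucc (n + 1)) a) n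
  refine ⟨fun i => match i with
    | Int.ofNat n => pos n
    | Int.negSucc n => neg n, ?_⟩
  rintro (n | _ | n)
  · exact hu _ _
  · exact hd _ _
  · exact hd _ _

namespace CochainComplex

variable {C : Type u} [Category.{v} C] [Preadditive C] {K L : CochainComplex C ℤ}

/-- A morphism `k` of complexes that is null-homotopic in degree `0` is null-homotopic if the
obstructions to extending a homotopy vanish in both directions. -/
lemma exists_homotopy_zero_of_extend (k : K ⟶ L)
    (left : ∀ (i j l : ℤ), i + 1 = j → j + 1 = l → ∀ a : K.X j ⟶ L.X j, a ≫ L.d j l = 0 →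
      ∃ b : K.X j ⟶ L.X i, b ≫ L.d i j = a)
    (right : ∀ (i j l : ℤ), i + 1 = j → j + 1 = l → ∀ a : K.X j ⟶ L.X j, K.d i j ≫ a = 0 →
      ∃ b : K.X l ⟶ L.X j, K.d j l ≫ b = a)
    (h₀ : k.f 0 = 0) : Nonempty (Homotopy k 0) := by
  -- An element at `i` holds the two homotopy maps, out of `K.X i` and `K.X (i + 1)`, that enter the
  -- equation in degree `i`; neighbours must agree on the shared one. Targets range over all `j` to
  -- avoid transport along equalities; only `i - 1` and `i` matter.
  let X : ℤ → Type v := fun i => { p : (∀ j, K.X i ⟶ L.X j) × (∀ j, K.X (i + 1) ⟶ L.X j) //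
    ∀ j, j + 1 = i → k.f i = p.1 j ≫ L.d j i + K.d i (i + 1) ≫ p.2 i }
  obtain ⟨y, hy⟩ := exists_int_family (X := X) (fun i p q => p.1.2 = q.1.1)
    ⟨⟨fun _ => 0, fun _ => 0⟩, fun j _ => by simp [h₀]⟩
    (fun i ⟨⟨p₁, p₂⟩, hp⟩ => by
      -- The equation in degree `i` says that the incoming differential kills the defect in degree
      -- `i + 1`.
      obtain ⟨b, hb⟩ := right i (i + 1) (i + 1 + 1) rfl rfl
        (k.f (i + 1) - p₂ i ≫ L.d i (i + 1)) (by
          rw [Preadditive.comp_sub, ← k.comm, hp (i - 1) (by lia), Preadditive.add_comp,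
            Category.assoc, L.d_comp_d, comp_zero, zero_add, Category.assoc, sub_self])
      refine ⟨⟨⟨p₂, fun j => if h : j = i + 1 then b ≫ eqToHom (by rw [h]) else 0⟩,
        fun j hj => ?_⟩, rfl⟩
      obtain rfl : j = i := by lia
      simp [hb])
    (fun i ⟨⟨q₁, q₂⟩, hq⟩ => by
      -- Downwards, the equation in degree `i + 1` says that the outgoing differential kills the
      -- defect in degree `i`.
      obtain ⟨b, hb⟩ := left (i - 1) i (i + 1) (by lia) rfl
        (k.f i - K.d i (i + 1) ≫ q₁ i) (by
          rw [Preadditive.sub_comp, k.comm, hq i rfl, Preadditive.comp_add,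
            ← Category.assoc (K.d i (i + 1)) (K.d _ _), K.d_comp_d, zero_comp, add_zero,
            Category.assoc, sub_self])
      refine ⟨⟨⟨fun j => if h : j = i - 1 then b ≫ eqToHom (by rw [h]) else 0, q₁⟩,
        fun j hj => ?_⟩, rfl⟩
      obtain rfl : j = i - 1 := by lia
      simp [hb])
  refine ⟨{ hom := fun i j => if j + 1 = i then (y i).1.1 j else 0
            zero := fun i j h => if_neg h
            comm := fun i => ?_ }⟩
  rw [dNext_eq _ (show (ComplexShape.up ℤ).Rel i (i + 1) from rfl),
    prevD_eq _ (show (ComplexShape.up ℤ).Rel (i - 1) i by simp), if_pos rfl,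
    if_pos (by lia), HomologicalComplex.zero_f, add_zero, add_comm, ← hy i]
  exact (y i).2 (i - 1) (by lia)

end CochainComplex

/-- By exactness `a` lands in the range of `f`, and `P` is projective. -/
lemma FGProj.exists_lift {R : Type u} [CommRing R] {P Q₁ Q₂ Q₃ : FGProj R} {f : Q₁ ⟶ Q₂}
    {g : Q₂ ⟶ Q₃} (hfg : Function.Exact (lin f) (lin g)) (a : P ⟶ Q₂) (ha : a ≫ g = 0) :
    ∃ b : P ⟶ Q₁, b ≫ f = a := by
  have := P.property.2
  have ha' : ∀ p, lin a p ∈ LinearMap.range (lin f) := fun p =>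
    (hfg _).1 (LinearMap.congr_fun (congrArg lin ha) p)
  obtain ⟨b, hb⟩ := Module.projective_lifting_property (lin f).rangeRestrict
    ((lin a).codRestrict _ ha') (LinearMap.surjective_rangeRestrict _)
  refine ⟨ObjectProperty.homMk (ModuleCat.ofHom b), ObjectProperty.hom_ext _ (ModuleCat.hom_ext
    (LinearMap.ext fun p => congrArg Subtype.val (LinearMap.congr_fun hb p)))⟩

lemma Int.bodd_ne_of_add_one_eq {i j : ℤ} (h : i + 1 = j) : i.bodd ≠ j.bodd := by
  subst h
  simp [Int.bodd_add]

/-! ### Lifting morphisms of `proj S/(x)` to `S` -/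

section RedHom

variable {S : Type u} [CommRing S] {x : S}
variable {N N' : Type u} [AddCommGroup N] [Module S N] [Module.Finite S N] [Module.Free S N]
  [AddCommGroup N'] [Module S N'] [Module.Finite S N'] [Module.Free S N']

lemma redHom_surjective : Function.Surjective (redHom x : (N →ₗ[S] N') → _) := fun g => by
  obtain ⟨f, hf⟩ := redMap_surjective (FGProj.lin g)
  exact ⟨f, ObjectProperty.hom_ext _ (ModuleCat.hom_ext hf)⟩

@[simp]
lemma redHom_add (f g : N →ₗ[S] N') : redHom x (f + g) = redHom x f + redHom x g :=
  ObjectProperty.hom_ext _ (ModuleCat.hom_ext (redMap_add f g))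

@[simp]
lemma redHom_neg (f : N →ₗ[S] N') : redHom x (-f) = -redHom x f :=
  ObjectProperty.hom_ext _ (ModuleCat.hom_ext (redMap_neg f))

@[simp]
lemma redHom_zero : redHom x (0 : N →ₗ[S] N') = 0 :=
  ObjectProperty.hom_ext _ (ModuleCat.hom_ext redMap_zero)

lemma exists_of_redHom_eq (hx : x ∈ nonZeroDivisors S) {f g : N →ₗ[S] N'}
    (h : redHom x f = redHom x g) : ∃ k : N →ₗ[S] N', f = g + x • k := by
  obtain ⟨k, hk⟩ := exists_smul_eq_of_redMap_eq_zero (f := f - g) hx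
    ((redMap_sub f g).trans (sub_eq_zero.2 (congrArg FGProj.lin h)))
  exact ⟨k, by rw [← hk, add_sub_cancel]⟩

end RedHom

/-! ### Total acyclicity; lifting chain maps and homotopies -/

namespace MF

variable {S : Type u} [CommRing S] {x : S}

lemma redD_exact (hx : x ∈ nonZeroDivisors S) (A : MF S x) {a b c : Bool} (hab : a ≠ b)
    (hbc : b ≠ c) : Function.Exact (FGProj.lin (A.redD a b)) (FGProj.lin (A.redD b c)) := by
  cases a <;> cases b <;> cases c <;> first
    | exact absurd rfl hab
    | exact absurd rfl hbc
    | exact redMap_exact hx A.ψ_comp_φ A.φ_comp_ψ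
    | exact redMap_exact hx A.φ_comp_ψ A.ψ_comp_φ

lemma redD_exact_dual (hx : x ∈ nonZeroDivisors S) (A : MF S x) {a b c : Bool} (hab : a ≠ b)
    (hbc : b ≠ c) :
    Function.Exact (FGProj.lin (A.redD b c)).dualMap (FGProj.lin (A.redD a b)).dualMap := by
  cases a <;> cases b <;> cases c <;> first
    | exact absurd rfl hab
    | exact absurd rfl hbc
    | exact redMap_exact_dual hx A.ψ_comp_φ A.φ_comp_ψ
    | exact redMap_exact_dual hx A.φ_comp_ψ A.ψ_comp_φ

lemma exists_redX_extension (hx : x ∈ nonZeroDivisors S) (A B : MF S x) {a b c e : Bool}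
    (hab : a ≠ b) (hbc : b ≠ c) (k : A.redX b ⟶ B.redX e) (hk : A.redD a b ≫ k = 0) :
    ∃ l : A.redX c ⟶ B.redX e, A.redD b c ≫ l = k := by
  have aux {N N' H : Type u} [AddCommGroup N] [Module S N] [Module.Finite S N] [Module.Free S N]
      [AddCommGroup N'] [Module S N'] [Module.Finite S N'] [Module.Free S N']
      [AddCommGroup H] [Module S H] [Module.Finite S H] [Module.Free S H]
      (f : N →ₗ[S] N') (g : N' →ₗ[S] N) (hfg : f ∘ₗ g = x • LinearMap.id)
      (k : redObj x N' ⟶ redObj x H) (hk : redHom x f ≫ k = 0) :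
      ∃ l : redObj x N ⟶ redObj x H, redHom x g ≫ l = k := by
    obtain ⟨l, hl⟩ := exists_eq_comp_redMap hx hfg (FGProj.lin k) (congrArg FGProj.lin hk)
    exact ⟨ObjectProperty.homMk (ModuleCat.ofHom l),
      ObjectProperty.hom_ext _ (ModuleCat.hom_ext hl.symm)⟩
  cases a <;> cases b <;> cases c <;> first
    | exact absurd rfl hab
    | exact absurd rfl hbc
    -- The split on `e` only lets `B.redX e` unfold to a reduced free module.
    | (cases e <;> exact aux A.φ A.ψ A.φ_comp_ψ k hk)
    | (cases e <;> exact aux A.ψ A.φ A.ψ_comp_φ k hk)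

lemma reduction_d (A : MF S x) {i j : ℤ} (h : i + 1 = j) :
    (reduction.obj A).d i j = A.redD i.bodd j.bodd := if_pos h

lemma reduction_isTotallyAcyclic (hx : x ∈ nonZeroDivisors S) (A : MF S x) :
    IsTotallyAcyclic (reduction.obj A) where
  exact i := by
    rw [reduction_d A (sub_add_cancel i 1), reduction_d A rfl]
    exact A.redD_exact hx (Int.bodd_ne_of_add_one_eq (sub_add_cancel i 1))
      (Int.bodd_ne_of_add_one_eq rfl)
  exact_dual i := by
    rw [reduction_d A (sub_add_cancel i 1), reduction_d A rfl]
    exact A.redD_exact_dual hx (Int.bodd_ne_of_add_one_eq (sub_add_cancel i 1))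
      (Int.bodd_ne_of_add_one_eq rfl)

instance : (reduction (S := S) (x := x)).Additive where
  map_add {A B θ η} := by
    ext1 n
    change redF (θ + η) n.bodd = redF θ n.bodd + redF η n.bodd
    cases n.bodd
    · exact redHom_add _ _
    · exact redHom_add _ _

lemma exists_homotopy_zero (hx : x ∈ nonZeroDivisors S) {A B : MF S x}
    (k : reduction.obj A ⟶ reduction.obj B) (h₀ : k.f 0 = 0) : Nonempty (Homotopy k 0) := by
  refine CochainComplex.exists_homotopy_zero_of_extend k ?_ ?_ h₀
  · intro i j l hij hjl a ha
    rw [reduction_d B hjl] at ha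
    rw [reduction_d B hij]
    exact FGProj.exists_lift (B.redD_exact hx (Int.bodd_ne_of_add_one_eq hij)
      (Int.bodd_ne_of_add_one_eq hjl)) a ha
  · intro i j l hij hjl a ha
    rw [reduction_d A hij] at ha
    rw [reduction_d A hjl]
    exact exists_redX_extension hx A B (Int.bodd_ne_of_add_one_eq hij)
      (Int.bodd_ne_of_add_one_eq hjl) a ha

lemma exists_homotopy_reduction_map (hx : x ∈ nonZeroDivisors S) {A B : MF S x}
    (k : reduction.obj A ⟶ reduction.obj B) :
    ∃ θ : A ⟶ B, Nonempty (Homotopy (reduction.map θ) k) := by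
  obtain ⟨f, hf⟩ := redHom_surjective (show redObj x A.F ⟶ redObj x B.F from k.f 0)
  obtain ⟨g, hg⟩ := redHom_surjective (show redObj x A.G ⟶ redObj x B.G from k.f 1)
  have hk : redHom x f ≫ redHom x B.φ = redHom x A.φ ≫ redHom x g := by
    rw [hf, hg]
    exact k.comm 0 1
  rw [redHom_comp_redHom, redHom_comp_redHom] at hk
  obtain ⟨u, hu⟩ := exists_of_redHom_eq hx hk
  -- Precomposed with `A.φ`, the correction `u ∘ₗ A.ψ` becomes `x • u`, exactly the error.
  have hφ : B.φ ∘ₗ f = (g + u ∘ₗ A.ψ) ∘ₗ A.φ := by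
    rw [hu, LinearMap.add_comp, LinearMap.comp_assoc A.φ A.ψ u, A.ψ_comp_φ, LinearMap.comp_smul,
      LinearMap.comp_id]
  have hψ : B.ψ ∘ₗ (g + u ∘ₗ A.ψ) = f ∘ₗ A.ψ := by
    apply smul_linearMap_cancel hx
    calc x • (B.ψ ∘ₗ (g + u ∘ₗ A.ψ))
        = B.ψ ∘ₗ ((g + u ∘ₗ A.ψ) ∘ₗ (A.φ ∘ₗ A.ψ)) := by
          rw [A.φ_comp_ψ, LinearMap.comp_smul, LinearMap.comp_smul, LinearMap.comp_id]
      _ = (B.ψ ∘ₗ B.φ) ∘ₗ (f ∘ₗ A.ψ) := by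
          rw [← LinearMap.comp_assoc A.ψ, ← hφ]; rfl
      _ = x • (f ∘ₗ A.ψ) := by
          rw [B.ψ_comp_φ, LinearMap.smul_comp, LinearMap.id_comp]
  let θ : A ⟶ B := { f := f, g := g + u ∘ₗ A.ψ, comm_φ := hφ, comm_ψ := hψ }
  -- Agreement in degree 0 is enough: `k` need not be 2-periodic, and `g + u ∘ₗ A.ψ` need not reduce
  -- to `k.f 1`.
  obtain ⟨h⟩ := exists_homotopy_zero hx (reduction.map θ - k) (sub_eq_zero.2 hf)
  exact ⟨θ, ⟨Homotopy.equivSubZero.symm h⟩⟩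

lemma homotopic_of_homotopy (hx : x ∈ nonZeroDivisors S) {A B : MF S x} {θ η : A ⟶ B}
    (h : Homotopy (reduction.map θ) (reduction.map η)) : homotopic θ η := by
  obtain ⟨s, hs⟩ := redHom_surjective (show redObj x A.G ⟶ redObj x B.F from h.hom 1 0)
  -- `Int.negSucc 0` is degree -1, which is odd, so the target is the reduction of `B.G`.
  obtain ⟨t, ht⟩ := redHom_surjective (show redObj x A.F ⟶ redObj x B.G from h.hom 0 (Int.negSucc 0))
  have h₀ : redHom x θ.f = redHom x A.φ ≫ redHom x s + redHom x t ≫ redHom x B.ψ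
      + redHom x η.f := by
    have := h.comm 0
    rw [dNext_eq _ (show (ComplexShape.up ℤ).Rel 0 1 from rfl),
      prevD_eq _ (show (ComplexShape.up ℤ).Rel (Int.negSucc 0) 0 from rfl)] at this
    rw [hs, ht]
    exact this
  rw [redHom_comp_redHom, redHom_comp_redHom, ← redHom_add, ← redHom_add] at h₀
  obtain ⟨u, hu⟩ := exists_of_redHom_eq hx h₀
  -- The remainder `x • u` equals `B.ψ ∘ₗ B.φ ∘ₗ u` and is absorbed in `t`.
  have hf : θ.f - η.f = s ∘ₗ A.φ + B.ψ ∘ₗ (t + B.φ ∘ₗ u) := by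
    rw [hu, LinearMap.comp_add, ← LinearMap.comp_assoc u, B.ψ_comp_φ, LinearMap.smul_comp,
      LinearMap.id_comp]
    abel
  refine ⟨s, t + B.φ ∘ₗ u, hf, smul_linearMap_cancel hx ?_⟩
  -- Multiplication by `x` is precomposition with `A.φ ∘ₗ A.ψ`, which turns the `g`-difference into
  -- the known `f`-difference.
  calc x • (θ.g - η.g) = (θ.g - η.g) ∘ₗ (A.φ ∘ₗ A.ψ) := by
        rw [A.φ_comp_ψ, LinearMap.comp_smul, LinearMap.comp_id]
    _ = (B.φ ∘ₗ (θ.f - η.f)) ∘ₗ A.ψ := by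
        rw [LinearMap.comp_sub, θ.comm_φ, η.comm_φ, ← LinearMap.sub_comp, LinearMap.comp_assoc]
    _ = (B.φ ∘ₗ s) ∘ₗ (A.φ ∘ₗ A.ψ) + (B.φ ∘ₗ B.ψ) ∘ₗ ((t + B.φ ∘ₗ u) ∘ₗ A.ψ) := by
        rw [hf, LinearMap.comp_add, LinearMap.add_comp]; rfl
    _ = x • ((t + B.φ ∘ₗ u) ∘ₗ A.ψ + B.φ ∘ₗ s) := by
        rw [A.φ_comp_ψ, B.φ_comp_ψ, LinearMap.comp_smul, LinearMap.comp_id, LinearMap.smul_comp,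
          LinearMap.id_comp, ← smul_add, add_comm]

/-- The reductions of homotopic morphisms are homotopic. -/
lemma exists_homotopy_of_homotopic {A B : MF S x} {θ η : A ⟶ B} (h : homotopic θ η) :
    Nonempty (Homotopy (reduction.map θ) (reduction.map η)) := by
  obtain ⟨s, t, hf, hg⟩ := h
  -- Equal parities get the value 0, which is never used: a homotopy only joins adjacent degrees.
  let σ : ∀ a b : Bool, A.redX a ⟶ B.redX b := fun a b => match a, b with
    | true, false => redHom x s
    | false, true => redHom x t
    | false, false => 0
    | true, true => 0
  have hσ : ∀ a b c : Bool, a ≠ b → b ≠ c →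
      redF θ b = A.redD b c ≫ σ c b + σ b a ≫ B.redD a b + redF η b := by
    have hf' : redHom x θ.f = redHom x A.φ ≫ redHom x s + redHom x t ≫ redHom x B.ψ
        + redHom x η.f := by
      rw [redHom_comp_redHom, redHom_comp_redHom, ← redHom_add, ← redHom_add, ← hf, sub_add_cancel]
    have hg' : redHom x θ.g = redHom x A.ψ ≫ redHom x t + redHom x s ≫ redHom x B.φ
        + redHom x η.g := by
      rw [redHom_comp_redHom, redHom_comp_redHom, ← redHom_add, ← redHom_add, ← hg, sub_add_cancel]
    intro a b c hab hbc
    cases a <;> cases b <;> cases c <;> first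
      | exact absurd rfl hab
      | exact absurd rfl hbc
      | exact hf'
      | exact hg'
  let σ' : ∀ i j : ℤ, (reduction.obj A).X i ⟶ (reduction.obj B).X j := fun i j =>
    σ i.bodd j.bodd
  refine ⟨{ hom := fun i j => if j + 1 = i then σ' i j else 0
            zero := fun i j h => if_neg h
            comm := fun i => ?_ }⟩
  rw [dNext_eq _ (show (ComplexShape.up ℤ).Rel i (i + 1) from rfl),
    prevD_eq _ (show (ComplexShape.up ℤ).Rel (i - 1) i by simp), if_pos rfl,
    if_pos (by lia), reduction_d A rfl, reduction_d B (sub_add_cancel i 1)]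
  exact hσ _ _ _ (Int.bodd_ne_of_add_one_eq (sub_add_cancel i 1)) (Int.bodd_ne_of_add_one_eq rfl)

end MF

/-! ### Suspension and shift -/

/-- Minus the identity, as an automorphism. -/
@[simps]
def CategoryTheory.Iso.negRefl {C : Type u} [Category.{v} C] [Preadditive C] (X : C) : X ≅ X where
  hom := -𝟙 X
  inv := -𝟙 X

namespace MF

variable {S : Type u} [CommRing S] {x : S}

/-- The reduction of `Σ A` in a given parity is the reduction of `A` in the other parity; the
identification is minus the identity. -/
def redSuspension (A : MF S x) : {a b : Bool} → a ≠ b → ((suspension.obj A).redX a ≅ A.redX b)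
  | false, true, _ => Iso.negRefl (redObj x A.G)
  | true, false, _ => Iso.negRefl (redObj x A.F)
  | false, false, h => absurd rfl h
  | true, true, h => absurd rfl h

lemma redSuspension_comm (A : MF S x) {a b c : Bool} (hab : a ≠ b) (hbc : b ≠ c) :
    (redSuspension A hab).hom ≫ A.redD b c =
      -(suspension.obj A).redD a b ≫ (redSuspension A hbc).hom := by
  have aux {N N' : Type u} [AddCommGroup N] [Module S N] [Module.Finite S N] [Module.Free S N]
      [AddCommGroup N'] [Module S N'] [Module.Finite S N'] [Module.Free S N'] (f : N →ₗ[S] N') :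
      (-𝟙 (redObj x N)) ≫ redHom x f = -redHom x (-f) ≫ (-𝟙 (redObj x N')) := by
    simp
  cases a <;> cases b <;> cases c <;> first
    | exact absurd rfl hab
    | exact absurd rfl hbc
    | exact aux A.φ
    | exact aux A.ψ

lemma redSuspension_naturality {A B : MF S x} (θ : A ⟶ B) {a b : Bool} (hab : a ≠ b) :
    redF (suspension.map θ) a ≫ (redSuspension B hab).hom =
      (redSuspension A hab).hom ≫ redF θ b := by
  have aux {N N' : Type u} [AddCommGroup N] [Module S N] [Module.Finite S N] [Module.Free S N]
      [AddCommGroup N'] [Module S N'] [Module.Finite S N'] [Module.Free S N'] (f : N →ₗ[S] N') :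
      redHom x f ≫ (-𝟙 (redObj x N')) = (-𝟙 (redObj x N)) ≫ redHom x f := by
    simp
  cases a <;> cases b <;> first
    | exact absurd rfl hab
    | exact aux θ.f
    | exact aux θ.g

/-- The reduction of the suspension is the shift of the reduction, by minus the identity in each
degree. -/
def reductionSuspensionIso (S : Type u) [CommRing S] (x : S) :
    suspension ⋙ reduction (S := S) (x := x) ≅
      reduction ⋙ shiftFunctor (CochainComplex (FGProj (S ⧸ Ideal.span {x})) ℤ) (1 : ℤ) :=
  NatIso.ofComponents
    (fun A => HomologicalComplex.Hom.isoOfComponents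
      (fun n => redSuspension A (Int.bodd_ne_of_add_one_eq (rfl : n + 1 = n + 1)))
      (by
        intro i j (hij : i + 1 = j)
        have h₁ : ((shiftFunctor (CochainComplex (FGProj (S ⧸ Ideal.span {x})) ℤ) (1 : ℤ)).obj
            (reduction.obj A)).d i j = -A.redD (i + 1).bodd (j + 1).bodd := by
          rw [CochainComplex.shiftFunctor_obj_d', Int.negOnePow_one, Units.neg_smul, one_smul,
            reduction_d A (by lia)]
          rfl
        have h₂ : (reduction.obj (suspension.obj A)).d i j =
          (suspension.obj A).redD i.bodd j.bodd := reduction_d _ hij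
        change _ ≫ ((shiftFunctor _ (1 : ℤ)).obj (reduction.obj A)).d i j =
          (reduction.obj (suspension.obj A)).d i j ≫ _
        rw [h₁, h₂]
        subst hij
        -- The sign in `redSuspension_comm` cancels the one in the differential of the shift.
        have := redSuspension_comm A (Int.bodd_ne_of_add_one_eq (rfl : i + 1 = i + 1))
          (Int.bodd_ne_of_add_one_eq (rfl : i + 1 + 1 = i + 1 + 1))
        exact (Preadditive.comp_neg _ _).trans ((congrArg Neg.neg this).trans (neg_neg _))))
    (fun θ => by
      ext1 n
      exact redSuspension_naturality θ _)

/-! ### The reduced mapping cone, parity by parity -/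

section Cone

variable {A B : MF S x} (θ : A ⟶ B)

/-- The component of the reduced mapping cone in the reduction of the source, which has the
opposite parity. -/
def redConeFst : (a b : Bool) → ((cone θ).redX a ⟶ A.redX b)
  | false, true => redHom x (LinearMap.fst S A.G B.F)
  | true, false => redHom x (LinearMap.fst S A.F B.G)
  | false, false => 0
  | true, true => 0

/-- The component of the reduced mapping cone in the reduction of the target. -/
def redConeSnd : (a : Bool) → ((cone θ).redX a ⟶ B.redX a)
  | false => redHom x (LinearMap.snd S A.G B.F)
  | true => redHom x (LinearMap.snd S A.F B.G)

/-- The inclusion of the reduction of the source, in the opposite parity. -/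
def redConeInl : (b a : Bool) → (A.redX b ⟶ (cone θ).redX a)
  | true, false => redHom x (LinearMap.inl S A.G B.F)
  | false, true => redHom x (LinearMap.inl S A.F B.G)
  | false, false => 0
  | true, true => 0

variable {a b c : Bool}

lemma redConeInl_redConeFst (h : a ≠ b) :
    redConeInl θ b a ≫ redConeFst θ a b = 𝟙 (A.redX b) := by
  cases a <;> cases b <;> first
    | exact absurd rfl h
    | exact (redHom_comp_redHom _ _).trans
        ((congrArg (redHom x) (LinearMap.fst_comp_inl ..)).trans (redHom_id _))

lemma redConeInl_redConeSnd : redConeInl θ b a ≫ redConeSnd θ a = 0 := by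
  cases a <;> cases b <;> first
    | exact zero_comp
    | exact (redHom_comp_redHom _ _).trans
        ((congrArg (redHom x) (LinearMap.snd_comp_inl ..)).trans redHom_zero)

lemma redF_coneInr_redConeFst : redF (coneInr θ) a ≫ redConeFst θ a b = 0 := by
  cases a <;> cases b <;> first
    | exact comp_zero
    | exact (redHom_comp_redHom _ _).trans
        ((congrArg (redHom x) (LinearMap.fst_comp_inr ..)).trans redHom_zero)

lemma redF_coneInr_redConeSnd : redF (coneInr θ) a ≫ redConeSnd θ a = 𝟙 (B.redX a) := by
  cases a <;> exact (redHom_comp_redHom _ _).trans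
    ((congrArg (redHom x) (LinearMap.snd_comp_inr ..)).trans (redHom_id _))

lemma redCone_id (h : a ≠ b) :
    redConeFst θ a b ≫ redConeInl θ b a + redConeSnd θ a ≫ redF (coneInr θ) a =
      𝟙 ((cone θ).redX a) := by
  have aux (M N : Type u) [AddCommGroup M] [Module S M] [Module.Finite S M] [Module.Free S M]
      [AddCommGroup N] [Module S N] [Module.Finite S N] [Module.Free S N] :
      redHom x (LinearMap.fst S M N) ≫ redHom x (LinearMap.inl S M N) +
        redHom x (LinearMap.snd S M N) ≫ redHom x (LinearMap.inr S M N) = 𝟙 (redObj x (M × N)) := by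
    rw [redHom_comp_redHom, redHom_comp_redHom, ← redHom_add, ← redHom_id]
    congr 1
    ext <;> simp
  cases a <;> cases b <;> first
    | exact absurd rfl h
    | exact aux _ _

/-- The sign comes from the entries `-ψ₁` and `-φ₁` of the cone; it makes this projection a cocycle
of degree 1. -/
lemma redD_redConeFst (hab : a ≠ b) (hbc : b ≠ c) :
    (cone θ).redD a b ≫ redConeFst θ b c = -redConeFst θ a b ≫ A.redD b c := by
  cases a <;> cases b <;> cases c <;> first
    | exact absurd rfl hab
    | exact absurd rfl hbc
    | (refine (redHom_comp_redHom _ _).trans (Eq.trans ?_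
        (congrArg Neg.neg (redHom_comp_redHom _ _).symm))
       refine Eq.trans ?_ (redHom_neg _)
       rfl)

lemma redD_redConeSnd (hab : a ≠ b) :
    (cone θ).redD a b ≫ redConeSnd θ b =
      redConeFst θ a b ≫ redF θ b + redConeSnd θ a ≫ B.redD a b := by
  cases a <;> cases b <;> first
    | exact absurd rfl hab
    | (refine (redHom_comp_redHom _ _).trans (Eq.trans ?_
        (congrArg₂ (· + ·) (redHom_comp_redHom _ _).symm (redHom_comp_redHom _ _).symm))
       refine Eq.trans ?_ (redHom_add _ _)
       rfl)

lemma redF_coneFst_redSuspension (hab : a ≠ b) :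
    redF (coneFst θ) a ≫ (redSuspension A hab).hom = -redConeFst θ a b := by
  cases a <;> cases b <;> first
    | exact absurd rfl hab
    | exact (Preadditive.comp_neg _ _).trans (congrArg Neg.neg (Category.comp_id _))

end Cone

end MF

/-! ### Reduction commutes with mapping cones -/

namespace MF

open CochainComplex.HomComplex

variable {S : Type u} [CommRing S] {x : S}

section Cone

variable {A B : MF S x} (θ : A ⟶ B)

/-- The component of the reduced mapping cone in the reduction of the source. -/
def coneFstDeg (n m : ℤ) : (reduction.obj (cone θ)).X n ⟶ (reduction.obj A).X m :=
  redConeFst θ n.bodd m.bodd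

/-- The component of the reduced mapping cone in the reduction of the target. -/
def coneSndDeg (n : ℤ) : (reduction.obj (cone θ)).X n ⟶ (reduction.obj B).X n :=
  redConeSnd θ n.bodd

/-- The inclusion of the reduction of the source in the reduced mapping cone. -/
def coneInlDeg (m n : ℤ) : (reduction.obj A).X m ⟶ (reduction.obj (cone θ)).X n :=
  redConeInl θ m.bodd n.bodd

variable {n m l : ℤ}

lemma coneInlDeg_coneFstDeg (h : n + 1 = m) : coneInlDeg θ m n ≫ coneFstDeg θ n m = 𝟙 _ :=
  redConeInl_redConeFst θ (Int.bodd_ne_of_add_one_eq h)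

lemma coneInlDeg_coneSndDeg : coneInlDeg θ m n ≫ coneSndDeg θ n = 0 :=
  redConeInl_redConeSnd θ

lemma coneInr_coneFstDeg : (reduction.map (coneInr θ)).f n ≫ coneFstDeg θ n m = 0 :=
  redF_coneInr_redConeFst θ

lemma coneInr_coneSndDeg : (reduction.map (coneInr θ)).f n ≫ coneSndDeg θ n = 𝟙 _ :=
  redF_coneInr_redConeSnd θ

lemma coneDeg_id (h : n + 1 = m) : coneFstDeg θ n m ≫ coneInlDeg θ m n +
    coneSndDeg θ n ≫ (reduction.map (coneInr θ)).f n = 𝟙 _ :=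
  redCone_id θ (Int.bodd_ne_of_add_one_eq h)

lemma d_coneFstDeg (h : n + 1 = m) (h' : m + 1 = l) :
    (reduction.obj (cone θ)).d n m ≫ coneFstDeg θ m l =
      -(coneFstDeg θ n m ≫ (reduction.obj A).d m l) := by
  rw [reduction_d A h', reduction_d (cone θ) h]
  exact redD_redConeFst θ (Int.bodd_ne_of_add_one_eq h) (Int.bodd_ne_of_add_one_eq h')

lemma d_coneSndDeg (h : n + 1 = m) :
    (reduction.obj (cone θ)).d n m ≫ coneSndDeg θ m =
      coneFstDeg θ n m ≫ (reduction.map θ).f m + coneSndDeg θ n ≫ (reduction.obj B).d n m := by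
  rw [reduction_d B h, reduction_d (cone θ) h]
  exact redD_redConeSnd θ (Int.bodd_ne_of_add_one_eq h)

/-- The projection of the reduced mapping cone to the reduction of the source, of degree `1`. -/
def reductionConeFst : Cocycle (reduction.obj (cone θ)) (reduction.obj A) 1 :=
  Cocycle.mk (Cochain.mk fun p q _ => coneFstDeg θ p q) 2 rfl <| Cochain.ext _ _ fun p q hpq => by
    -- The sign in `δ` is `(-1)^2 = 1`, so the two terms cancel because the projection anticommutes
    -- with the differentials.
    rw [δ_v 1 2 rfl _ p q hpq (q - 1) (p + 1) rfl rfl, Int.negOnePow_even 2 even_two, one_smul,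
      Cochain.mk_v, Cochain.mk_v, d_coneFstDeg θ rfl (by lia)]
    obtain rfl : q = p + 1 + 1 := by lia
    rw [add_sub_cancel_right, add_neg_cancel, Cochain.zero_v]

/-- The projection of the reduced mapping cone to the reduction of the target, of degree `0`. -/
def reductionConeSnd : Cochain (reduction.obj (cone θ)) (reduction.obj B) 0 :=
  Cochain.ofHoms (coneSndDeg θ)

/-- The compatibility that `mappingCone.lift` requires; it is the second row of the differential of
the cone. -/
lemma δ_reductionConeSnd : δ 0 1 (reductionConeSnd θ) +
    (reductionConeFst θ).1.comp (Cochain.ofHom (reduction.map θ)) (add_zero 1) = 0 :=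
  Cochain.ext _ _ fun p q hpq => by
    rw [Cochain.add_v, Cochain.comp_zero_cochain_v, Cochain.ofHom_v, δ_zero_cochain_v,
      reductionConeSnd, Cochain.ofHoms_v, Cochain.ofHoms_v, Cochain.zero_v, d_coneSndDeg θ hpq]
    change _ + coneFstDeg θ p q ≫ _ = 0
    abel

/-- The comparison from the reduction of the mapping cone to the mapping cone of the
reduction. -/
def reductionConeHom : reduction.obj (cone θ) ⟶ CochainComplex.mappingCone (reduction.map θ) :=
  CochainComplex.mappingCone.lift _ (reductionConeFst θ) (reductionConeSnd θ)
    (δ_reductionConeSnd θ)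

lemma reductionConeHom_f_fst (h : n + 1 = m) : (reductionConeHom θ).f n ≫
    (CochainComplex.mappingCone.fst (reduction.map θ)).1.v n m h = coneFstDeg θ n m :=
  CochainComplex.mappingCone.lift_f_fst_v ..

lemma reductionConeHom_f_snd : (reductionConeHom θ).f n ≫
    (CochainComplex.mappingCone.snd (reduction.map θ)).v n n (add_zero n) = coneSndDeg θ n :=
  (CochainComplex.mappingCone.lift_f_snd_v ..).trans (Cochain.ofHoms_v ..)

/-- The inverse of the comparison in each degree. -/
def reductionConeInv (n : ℤ) :
    (CochainComplex.mappingCone (reduction.map θ)).X n ⟶ (reduction.obj (cone θ)).X n :=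
  (CochainComplex.mappingCone.fst (reduction.map θ)).1.v n (n + 1) rfl ≫ coneInlDeg θ (n + 1) n +
    (CochainComplex.mappingCone.snd (reduction.map θ)).v n n (add_zero n) ≫
      (reduction.map (coneInr θ)).f n

lemma reductionConeHom_f_comp_inv (n : ℤ) :
    (reductionConeHom θ).f n ≫ reductionConeInv θ n = 𝟙 _ := by
  rw [reductionConeInv, Preadditive.comp_add, ← Category.assoc, reductionConeHom_f_fst,
    ← Category.assoc, reductionConeHom_f_snd, coneDeg_id θ rfl]

lemma reductionConeInv_comp_hom_f (n : ℤ) :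
    reductionConeInv θ n ≫ (reductionConeHom θ).f n = 𝟙 _ := by
  apply CochainComplex.mappingCone.ext_to _ n (n + 1) rfl
  · rw [Category.id_comp, Category.assoc, reductionConeHom_f_fst, reductionConeInv,
      Preadditive.add_comp, Category.assoc, Category.assoc, coneInlDeg_coneFstDeg θ rfl,
      coneInr_coneFstDeg, comp_zero, Category.comp_id, add_zero]
  · rw [Category.id_comp, Category.assoc, reductionConeHom_f_snd, reductionConeInv,
      Preadditive.add_comp, Category.assoc, Category.assoc, coneInlDeg_coneSndDeg,
      coneInr_coneSndDeg, comp_zero, Category.comp_id, zero_add]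

/-- The reduction of the mapping cone is the mapping cone of the reduction. -/
def reductionConeIso :
    reduction.obj (cone θ) ≅ CochainComplex.mappingCone (reduction.map θ) :=
  HomologicalComplex.Hom.isoOfComponents
    (fun n => ⟨(reductionConeHom θ).f n, reductionConeInv θ n, reductionConeHom_f_comp_inv θ n,
      reductionConeInv_comp_hom_f θ n⟩)
    (fun i j _ => (reductionConeHom θ).comm i j)

lemma reduction_coneInr_comp_coneIso :
    reduction.map (coneInr θ) ≫ (reductionConeIso θ).hom =
      CochainComplex.mappingCone.inr (reduction.map θ) := by
  ext1 n
  change (reduction.map (coneInr θ)).f n ≫ (reductionConeHom θ).f n = _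
  apply CochainComplex.mappingCone.ext_to _ n (n + 1) rfl
  · rw [Category.assoc, reductionConeHom_f_fst, CochainComplex.mappingCone.inr_f_fst_v,
      coneInr_coneFstDeg]
  · rw [Category.assoc, reductionConeHom_f_snd, CochainComplex.mappingCone.inr_f_snd_v,
      coneInr_coneSndDeg]

lemma reductionConeIso_comp_mor₃ :
    (reductionConeIso θ).hom ≫ (CochainComplex.mappingCone.triangle (reduction.map θ)).mor₃ =
      reduction.map (coneFst θ) ≫ (reductionSuspensionIso S x).hom.app A := by
  ext1 n
  -- This minus sign is matched by the one in `redSuspension`.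
  have h₁ : (CochainComplex.mappingCone.triangle (reduction.map θ)).mor₃.f n =
      -(CochainComplex.mappingCone.fst (reduction.map θ)).1.v n (n + 1) rfl := by
    simp [CochainComplex.mappingCone.triangle,
      Cochain.rightShift_v _ 1 0 (zero_add 1) n n (add_zero n) (n + 1) rfl]
    exact congrArg Neg.neg (Category.comp_id _)
  have h₂ := redF_coneFst_redSuspension θ (Int.bodd_ne_of_add_one_eq (rfl : n + 1 = n + 1))
  change (reductionConeHom θ).f n ≫ _ = _
  rw [h₁]
  exact (Preadditive.comp_neg _ _).trans ((congrArg Neg.neg (reductionConeHom_f_fst θ rfl)).trans h₂.symm)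

/-- The reduction of the standard triangle on `θ` is the standard triangle on the reduction
of `θ`. -/
def reductionTriangleIso :
    Triangle.mk (reduction.map θ) (reduction.map (coneInr θ))
      (reduction.map (coneFst θ) ≫ (reductionSuspensionIso S x).hom.app A) ≅
    CochainComplex.mappingCone.triangle (reduction.map θ) :=
  Triangle.isoMk _ _ (Iso.refl _) (Iso.refl _) (reductionConeIso θ)
    ((Category.comp_id _).trans (Category.id_comp _).symm)
    ((reduction_coneInr_comp_coneIso θ).trans (Category.id_comp _).symm)
    ((congrArg _ (CategoryTheory.Functor.map_id _ _)).trans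
      ((Category.comp_id _).trans (reductionConeIso_comp_mor₃ θ).symm))

end Cone

end MF

/-! ### The functor on homotopy categories and its triangles -/

namespace HMF

variable {S : Type u} [CommRing S] {x : S}

/-- The functor on homotopy categories induced by reduction modulo `x`. -/
def reduction (S : Type u) [CommRing S] (x : S) :
    HMF S x ⥤ HomotopyCategory (FGProj (S ⧸ Ideal.span {x})) (ComplexShape.up ℤ) :=
  CategoryTheory.Quotient.lift _ (MF.reduction ⋙ HomotopyCategory.quotient _ _)
    (fun _ _ _ _ h => (MF.exists_homotopy_of_homotopic h).elim
      fun h => HomotopyCategory.eq_of_homotopy _ _ h)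

instance : (quotient (S := S) (x := x)).Additive where
  map_add := rfl

instance : (reduction S x).Additive where
  map_add {X Y a b} := by
    obtain ⟨a, rfl⟩ := quotient.map_surjective (X := X.as) (Y := Y.as) a
    obtain ⟨b, rfl⟩ := quotient.map_surjective (X := X.as) (Y := Y.as) b
    exact (MF.reduction ⋙ HomotopyCategory.quotient _ _).map_add (f := a) (g := b)

/-- Reduction to the homotopy category commutes with the suspensions. -/
def reductionSuspensionIso (S : Type u) [CommRing S] (x : S) :
    suspension ⋙ reduction S x ≅ reduction S x ⋙ shiftFunctor _ (1 : ℤ) :=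
  CategoryTheory.Quotient.natIsoLift _
    (Functor.isoWhiskerRight (MF.reductionSuspensionIso S x) (HomotopyCategory.quotient _ _) ≪≫
      Functor.isoWhiskerLeft MF.reduction
        ((HomotopyCategory.quotient _ (ComplexShape.up ℤ)).commShiftIso (1 : ℤ)))

lemma reduction_full (hx : x ∈ nonZeroDivisors S) : (reduction S x).Full where
  map_surjective {X Y} f := by
    obtain ⟨k, rfl⟩ := (HomotopyCategory.quotient _ (ComplexShape.up ℤ)).map_surjective
      (X := MF.reduction.obj X.as) (Y := MF.reduction.obj Y.as) f
    obtain ⟨θ, ⟨h⟩⟩ := MF.exists_homotopy_reduction_map hx k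
    exact ⟨quotient.map θ, HomotopyCategory.eq_of_homotopy _ _ h⟩

lemma reduction_faithful (hx : x ∈ nonZeroDivisors S) : (reduction S x).Faithful where
  map_injective {X Y a b} h := by
    obtain ⟨a, rfl⟩ := quotient.map_surjective (X := X.as) (Y := Y.as) a
    obtain ⟨b, rfl⟩ := quotient.map_surjective (X := X.as) (Y := Y.as) b
    exact CategoryTheory.Quotient.sound _
      (MF.homotopic_of_homotopy hx (HomotopyCategory.homotopyOfEq _ _ h))

/-- The image of `MF.reductionTriangleIso` in the homotopy category. The third maps agree because
the suspension isomorphism was built with the `commShiftIso` that `mapTriangle` uses. -/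
lemma reduction_standard_distinguished {A B : MF S x} (θ : A ⟶ B) :
    Triangle.mk ((reduction S x).map (quotient.map θ))
      ((reduction S x).map (quotient.map (MF.coneInr θ)))
      ((reduction S x).map (coneFst θ) ≫ (reductionSuspensionIso S x).hom.app (quotient.obj A)) ∈
        distTriang (HomotopyCategory (FGProj (S ⧸ Ideal.span {x})) (ComplexShape.up ℤ)) := by
  refine isomorphic_distinguished _
    (HomotopyCategory.mappingCone_triangleh_distinguished (MF.reduction.map θ)) _
    (?_ ≪≫ (HomotopyCategory.quotient _ _).mapTriangle.mapIso (MF.reductionTriangleIso θ))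
  refine Triangle.isoMk _ _ (Iso.refl _) (Iso.refl _) (Iso.refl _)
    ((Category.comp_id _).trans (Category.id_comp _).symm)
    ((Category.comp_id _).trans (Category.id_comp _).symm) ?_
  refine (congrArg _ (CategoryTheory.Functor.map_id _ _)).trans
    ((Category.comp_id _).trans (Eq.trans ?_ (Category.id_comp _).symm))
  exact (Category.assoc _ _ _).symm.trans
    (congrArg (· ≫ _) ((HomotopyCategory.quotient _ _).map_comp _ _).symm)

lemma reduction_distinguished {X Y Z : HMF S x} {a : X ⟶ Y} {b : Y ⟶ Z}
    {c : Z ⟶ suspension.obj X} (h : Distinguished a b c) :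
    Triangle.mk ((reduction S x).map a) ((reduction S x).map b)
      ((reduction S x).map c ≫ (reductionSuspensionIso S x).hom.app X) ∈
        distTriang (HomotopyCategory (FGProj (S ⧸ Ideal.span {x})) (ComplexShape.up ℤ)) := by
  obtain ⟨A, B, θ, e₁, e₂, e₃, h₁, h₂, h₃⟩ := h
  refine isomorphic_distinguished _ (reduction_standard_distinguished θ) _
    (Triangle.isoMk _ _ ((reduction S x).mapIso e₁) ((reduction S x).mapIso e₂)
      ((reduction S x).mapIso e₃) ?_ ?_ ?_)
  · exact ((reduction S x).map_comp _ _).symm.trans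
      ((congrArg (reduction S x).map h₁).trans ((reduction S x).map_comp _ _))
  · exact ((reduction S x).map_comp _ _).symm.trans
      ((congrArg (reduction S x).map h₂).trans ((reduction S x).map_comp _ _))
  -- The third square combines the third square in `HMF` with naturality of the suspension
  -- isomorphism at `e₁`.
  · have hn := (reductionSuspensionIso S x).hom.naturality e₁.hom
    have hc := congrArg (reduction S x).map h₃
    rw [Functor.map_comp, Functor.map_comp] at hc
    change ((reduction S x).map c ≫ (reductionSuspensionIso S x).hom.app X) ≫
      ((reduction S x).map e₁.hom)⟦(1 : ℤ)⟧' = (reduction S x).map e₃.hom ≫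
        (reduction S x).map (coneFst θ) ≫ (reductionSuspensionIso S x).hom.app (quotient.obj A)
    rw [Category.assoc, ← Category.assoc ((reduction S x).map e₃.hom), ← hc, Category.assoc]
    exact congrArg _ hn.symm

/-- The functor to totally acyclic complexes induced by reduction modulo a non-zero-divisor. -/
def toKtac (hx : x ∈ nonZeroDivisors S) : HMF S x ⥤ Ktac (S ⧸ Ideal.span {x}) :=
  (totallyAcyclic _).lift (reduction S x) fun X => MF.reduction_isTotallyAcyclic hx X.as

lemma toKtac_full (hx : x ∈ nonZeroDivisors S) : (toKtac hx).Full :=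
  have : (toKtac hx ⋙ (totallyAcyclic (S ⧸ Ideal.span {x})).ι).Full := reduction_full hx
  Functor.Full.of_comp_faithful _ (totallyAcyclic (S ⧸ Ideal.span {x})).ι

lemma toKtac_faithful (hx : x ∈ nonZeroDivisors S) : (toKtac hx).Faithful :=
  have : (toKtac hx ⋙ (totallyAcyclic (S ⧸ Ideal.span {x})).ι).Faithful := reduction_faithful hx
  Functor.Faithful.of_comp _ (totallyAcyclic (S ⧸ Ideal.span {x})).ι

/-- The functor to totally acyclic complexes commutes with the suspensions. -/
def toKtacSuspensionIso (hx : x ∈ nonZeroDivisors S) :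
    suspension ⋙ toKtac hx ≅ toKtac hx ⋙ shiftFunctor (Ktac (S ⧸ Ideal.span {x})) (1 : ℤ) :=
  Functor.fullyFaithfulCancelRight (totallyAcyclic (S ⧸ Ideal.span {x})).ι
    (show suspension ⋙ reduction S x ≅ _ from
      reductionSuspensionIso S x ≪≫ Functor.isoWhiskerLeft (toKtac hx)
        ((totallyAcyclic (S ⧸ Ideal.span {x})).ι.commShiftIso (1 : ℤ)).symm)

/-- Lets triangles be compared after the inclusion `ι`, where the suspension isomorphism is the
known one. -/
lemma ι_map_toKtacSuspensionIso (hx : x ∈ nonZeroDivisors S) (X : HMF S x) :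
    (totallyAcyclic (S ⧸ Ideal.span {x})).ι.map ((toKtacSuspensionIso hx).hom.app X) ≫
      ((totallyAcyclic (S ⧸ Ideal.span {x})).ι.commShiftIso (1 : ℤ)).hom.app
        ((toKtac hx).obj X) = (reductionSuspensionIso S x).hom.app X := by
  have h : (totallyAcyclic (S ⧸ Ideal.span {x})).ι.map ((toKtacSuspensionIso hx).hom.app X) =
      (reductionSuspensionIso S x).hom.app X ≫
        ((totallyAcyclic (S ⧸ Ideal.span {x})).ι.commShiftIso (1 : ℤ)).inv.app
          ((toKtac hx).obj X) :=
    Functor.map_preimage _ _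
  rw [h]
  refine (Category.assoc _ _ _).trans ?_
  exact (congrArg _ (Iso.inv_hom_id_app _ _)).trans (Category.comp_id _)

lemma toKtac_isTriangleFunctor (hx : x ∈ nonZeroDivisors S) :
    IsTriangleFunctor (toKtac hx) (toKtacSuspensionIso hx) where
  additive := ⟨fun {_ _ f g} => ObjectProperty.hom_ext _ ((reduction S x).map_add (f := f) (g := g))⟩
  map_distinguished {X Y Z} a b c h := by
    -- Distinguished triangles of the full subcategory are those with distinguished image under `ι`.
    change (totallyAcyclic (S ⧸ Ideal.span {x})).ι.mapTriangle.obj _ ∈ distTriang _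
    refine isomorphic_distinguished _ (reduction_distinguished h) _
      (Triangle.isoMk _ _ (Iso.refl _) (Iso.refl _) (Iso.refl _)
        ((Category.comp_id _).trans (Category.id_comp _).symm)
        ((Category.comp_id _).trans (Category.id_comp _).symm) ?_)
    refine (congrArg _ (CategoryTheory.Functor.map_id _ _)).trans
      ((Category.comp_id _).trans (Eq.trans ?_ (Category.id_comp _).symm))
    refine (congrArg (· ≫ _) (Functor.map_comp _ _ _)).trans ((Category.assoc _ _ _).trans ?_)
    exact congrArg _ (ι_map_toKtacSuspensionIso hx X)

end HMF

end

theorem theorem3p4 (S : Type u) [CommRing S] (x : S) (hx : x ∈ nonZeroDivisors S) :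
    (∀ A : MF S x, IsTotallyAcyclic (MF.reduction.obj A)) ∧
    ∃ T : HMF S x ⥤ Ktac (S ⧸ Ideal.span {x}),
      HMF.quotient ⋙ T ⋙ (totallyAcyclic (S ⧸ Ideal.span {x})).ι =
        MF.reduction ⋙ HomotopyCategory.quotient _ _ ∧
      (∃ ξ : HMF.suspension ⋙ T ≅ T ⋙ shiftFunctor (Ktac (S ⧸ Ideal.span {x})) (1 : ℤ),
        IsTriangleFunctor T ξ) ∧
      T.Full ∧ T.Faithful := by
  -- `rfl` suffices: the lifts to the quotient and to the full subcategory compute definitionally.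
  exact ⟨MF.reduction_isTotallyAcyclic hx, HMF.toKtac hx, rfl,
    ⟨HMF.toKtacSuspensionIso hx, HMF.toKtac_isTriangleFunctor hx⟩,
    HMF.toKtac_full hx, HMF.toKtac_faithful hx⟩
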